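/- Call a set $A\subseteq\mathbb R^3$ able to hide behind a set $B\subseteq\mathbb R^3$ if for every unit vector $u$ the orthogonal projection of $B$ onto the plane $u^\perp$ contains a translate of the orthogonal projection of $A$ onto $u^\perp$. Let $T\subset\mathbb R^3$ be a (solid) regular tetrahedron with edge length $1$, let $-T=\{-x : x\in T\}$ be the inverted tetrahedron, and let $\alpha T+\beta(-T)=\{\alpha x-\beta y : x,y\in T\}$ be their Minkowski interpolations. Put $\alpha^*=\frac{1+2\sqrt{14}}{11}$. Then: (1) for every $\alpha\in[0,1]$ the body $\alpha T+\frac{1-\alpha}{2}(-T)$ can hide behind $T$; (2) $\alpha^*\in[0,1]$, and among the bodies in (1) the volume ratio $V\big(\alpha T+\frac{1-\alpha}{2}(-T)\big)/V(T)$ is maximized at $\alpha=\alpha^*$ and at no other $\alpha\in[0,1]$; (3) the volume ratio attained at $\alpha=\alpha^*$ is also the maximum of $V(\alpha T+\beta(-T))/V(T)$ over all $\alpha,\beta\ge 0$ for which $\alpha T+\beta(-T)$ can hide behind $T$; (4) the maximal ratio equals $\frac{36+28\sqrt{14}}{121}$. Numerically, $\alpha^*\approx 0.77121043$ (with error less than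 $5\cdot 10^{-9}$) and the maximal ratio is $\approx 1.1633587$ (with error less than $5\cdot 10^{-8}$). -/

import Mathlib

open Set MeasureTheory
open scoped Pointwise

/-- `A` can hide behind `B`: for every direction (unit vector) `u`, the orthogonal projection of `B`
onto the hyperplane `u^⊥` contains a translate (within `u^⊥`) of the orthogonal projection of `A`
onto `u^⊥`. -/
def CanHideBehind {n : ℕ} (A B : Set (EuclideanSpace ℝ (Fin n))) : Prop :=
  ∀ u : EuclideanSpace ℝ (Fin n), ‖u‖ = 1 →
    ∃ x : (Submodule.span ℝ {u})ᗮ,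
      x +ᵥ ((Submodule.span ℝ {u})ᗮ.orthogonalProjectionOnto '' A) ⊆
        (Submodule.span ℝ {u})ᗮ.orthogonalProjectionOnto '' B

/-- The Minkowski interpolation `α A + β B` of two sets with scaling constants `α` and `β`. -/
def minkowskiInterpolation {n : ℕ} (α β : ℝ) (A B : Set (EuclideanSpace ℝ (Fin n))) :
    Set (EuclideanSpace ℝ (Fin n)) :=
  α • A + β • B

/-- `T` is a (solid) regular tetrahedron of edge length one in three-dimensional Euclidean space:
the convex hull of four points at mutual distance one. -/
def IsUnitRegularTetrahedron (T : Set (EuclideanSpace ℝ (Fin 3))) : Prop :=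
  ∃ p : Fin 4 → EuclideanSpace ℝ (Fin 3),
    (∀ i j, i ≠ j → dist (p i) (p j) = 1) ∧ T = convexHull ℝ (range p)

/-- The volume ratio `V(A) / V(B)`, as a real number. -/
noncomputable def volumeRatio {n : ℕ} (A B : Set (EuclideanSpace ℝ (Fin n))) : ℝ :=
  volume.real A / volume.real B

/-! Hiding: a projection of `T` to a plane is the hull `K` of four affinely dependent points, and
such a `K` contains a translate `x - K/2`. By convexity it contains a translate of `α K - ((1 -
α)/2) K`, the shadow of the family's body (`exists_sub_half_mem_convexHull`).

Conversely, along an altitude the shadow of `T` is a triangle. Three functionals summing to zero,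
one per side, give `α + 2β ≤ 1` whenever `α T + β(-T)` hides
(`add_two_mul_le_one_of_canHideBehind`), so the family is the extremal boundary.

Volume: an affine map turns `T` into the corner simplex `S`, and slicing gives the volume of `a S -
b S`, hence the ratio `α³ + 9α²β + 9αβ² + β³`. This increases in `β`; on `β = (1 - α)/2` it is a
cubic in `α` whose critical equation is `11α² = 2α + 5`. -/

/-! ### Volume of differences of corner simplices. -/

/-- The Minkowski difference `a S - b S` of dilates of the corner simplex `S` in `ℝⁿ`. -/
def cornerDifference (n : ℕ) (a b : ℝ) : Set (Fin n → ℝ) :=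
  {z | ∑ i, max (z i) 0 ≤ a ∧ ∑ i, max (-z i) 0 ≤ b}

theorem measurableSet_cornerDifference (n : ℕ) (a b : ℝ) :
    MeasurableSet (cornerDifference n a b) := by
  apply IsClosed.measurableSet
  have h1 : Continuous fun z : Fin n → ℝ => ∑ i, max (z i) 0 := by fun_prop
  have h2 : Continuous fun z : Fin n → ℝ => ∑ i, max (-z i) 0 := by fun_prop
  exact (isClosed_le h1 continuous_const).inter (isClosed_le h2 continuous_const)

theorem cornerDifference_eq_empty {n : ℕ} {a b : ℝ} (h : a < 0 ∨ b < 0) :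
    cornerDifference n a b = ∅ := by
  ext z
  simp only [cornerDifference, mem_ofPred_eq, mem_empty_iff_false, iff_false, not_and]
  have h1 : 0 ≤ ∑ i, max (z i) 0 := Finset.sum_nonneg fun i _ => le_max_right _ _
  have h2 : 0 ≤ ∑ i, max (-z i) 0 := Finset.sum_nonneg fun i _ => le_max_right _ _
  rcases h with h | h
  · intro h3; linarith
  · intro _ h3; linarith

/-- Fubini in the first coordinate `t`: a positive `t` uses up part of the bound `a`, a negative one
part of `b`. -/
theorem volume_cornerDifference_succ (n : ℕ) (a b : ℝ) :
    volume (cornerDifference (n + 1) a b) =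
      ∫⁻ t : ℝ, volume (cornerDifference n (a - max t 0) (b - max (-t) 0)) := by
  have hm := (volume_preserving_piFinSuccAbove (fun _ : Fin (n + 1) => ℝ) 0).symm
  rw [← hm.measure_preimage (measurableSet_cornerDifference _ _ _).nullMeasurableSet,
    Measure.volume_eq_prod,
    Measure.prod_apply (hm.measurable (measurableSet_cornerDifference _ _ _))]
  refine lintegral_congr fun t => congrArg _ ?_
  ext z
  simp only [mem_preimage, cornerDifference, mem_ofPred_eq, Fin.sum_univ_succ,
    MeasurableEquiv.piFinSuccAbove_symm_apply, Fin.insertNthEquiv_apply, Fin.insertNth_zero,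
    Fin.cons_zero, Fin.cons_succ]
  constructor <;> rintro ⟨h1, h2⟩ <;> constructor <;>
    simp only [cast_eq] at * <;> linarith

theorem volume_cornerDifference_step {n : ℕ} {G : ℝ → ℝ → ℝ}
    (hc : Continuous fun q : ℝ × ℝ => G q.1 q.2)
    (hpos : ∀ a b, 0 ≤ a → 0 ≤ b → 0 ≤ G a b)
    (hG : ∀ a b, 0 ≤ a → 0 ≤ b → volume (cornerDifference n a b) = ENNReal.ofReal (G a b))
    {a b : ℝ} (ha : 0 ≤ a) (hb : 0 ≤ b) :
    volume (cornerDifference (n + 1) a b) =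
      ENNReal.ofReal ((∫ t in 0..a, G (a - t) b) + ∫ t in 0..b, G a (b - t)) := by
  set H : ℝ → ℝ := fun t => G (a - max t 0) (b - max (-t) 0) with hH
  have hHc : Continuous H :=
    hc.comp (f := fun t : ℝ => (a - max t 0, b - max (-t) 0)) (by fun_prop)
  -- Outside `[-b, a]` one of the remaining bounds is negative and the slice is empty, so the
  -- formula `G` is only needed for nonnegative arguments.
  have hind : ∀ t : ℝ, volume (cornerDifference n (a - max t 0) (b - max (-t) 0)) =
      (Icc (-b) a).indicator (fun t => ENNReal.ofReal (H t)) t := by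
    intro t
    by_cases ht : t ∈ Icc (-b) a
    · rw [indicator_of_mem ht]
      exact hG _ _ (sub_nonneg.2 (max_le ht.2 ha)) (sub_nonneg.2 (max_le (by linarith [ht.1]) hb))
    · rw [indicator_of_notMem ht, cornerDifference_eq_empty, measure_empty]
      by_contra! h
      exact ht ⟨by linarith [le_max_left (-t) 0], by linarith [le_max_left t 0]⟩
  rw [volume_cornerDifference_succ, lintegral_congr hind, lintegral_indicator measurableSet_Icc,
    ← ofReal_integral_eq_lintegral_ofReal hHc.continuousOn.integrableOn_Icc
      ((ae_restrict_iff' measurableSet_Icc).2 (Filter.Eventually.of_forall fun t ht =>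
        hpos _ _ (sub_nonneg.2 (max_le ht.2 ha))
          (sub_nonneg.2 (max_le (by linarith [ht.1]) hb)))),
    integral_Icc_eq_integral_Ioc, ← intervalIntegral.integral_of_le (by linarith),
    ← intervalIntegral.integral_add_adjacent_intervals (μ := volume)
      (hHc.intervalIntegrable (-b) 0) (hHc.intervalIntegrable 0 a), add_comm]
  congr 2
  · refine intervalIntegral.integral_congr fun t ht => ?_
    rw [uIcc_of_le ha] at ht
    simp [hH, ht.1]
  · have h : (∫ t in (-b)..0, H t) = ∫ t in 0..b, H (-t) := by
      rw [intervalIntegral.integral_comp_neg, neg_zero]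
    rw [h]
    refine intervalIntegral.integral_congr fun t ht => ?_
    rw [uIcc_of_le hb] at ht
    simp [hH, ht.1]

theorem volume_cornerDifference_zero {a b : ℝ} (ha : 0 ≤ a) (hb : 0 ≤ b) :
    volume (cornerDifference 0 a b) = ENNReal.ofReal 1 := by
  have : cornerDifference 0 a b = univ := by
    ext z; simp [cornerDifference, ha, hb]
  rw [this]; simp [volume_pi]

theorem volume_cornerDifference_one {a b : ℝ} (ha : 0 ≤ a) (hb : 0 ≤ b) :
    volume (cornerDifference 1 a b) = ENNReal.ofReal (a + b) := by
  rw [volume_cornerDifference_step (G := fun _ _ => 1) (by fun_prop) (fun _ _ _ _ => zero_le_one)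
    (fun _ _ ha hb => volume_cornerDifference_zero ha hb) ha hb]
  simp

theorem volume_cornerDifference_two {a b : ℝ} (ha : 0 ≤ a) (hb : 0 ≤ b) :
    volume (cornerDifference 2 a b) = ENNReal.ofReal (a ^ 2 / 2 + 2 * a * b + b ^ 2 / 2) := by
  rw [volume_cornerDifference_step (G := fun a b => a + b) (by fun_prop)
    (fun _ _ => add_nonneg) (fun _ _ ha hb => volume_cornerDifference_one ha hb) ha hb]
  congr 1
  have h1 : ∀ c d : ℝ, (∫ t in 0..c, (c - t + d)) = c ^ 2 / 2 + c * d := by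
    intro c d
    rw [intervalIntegral.integral_comp_sub_left (fun t => t + d),
      intervalIntegral.integral_add
        (Continuous.intervalIntegrable (by fun_prop) _ _)
        (Continuous.intervalIntegrable (by fun_prop) _ _)]
    simp
  simp_rw [add_comm a]
  rw [h1, h1]; ring

theorem volume_cornerDifference_three {a b : ℝ} (ha : 0 ≤ a) (hb : 0 ≤ b) :
    volume (cornerDifference 3 a b) =
      ENNReal.ofReal ((a ^ 3 + 9 * a ^ 2 * b + 9 * a * b ^ 2 + b ^ 3) / 6) := by
  rw [volume_cornerDifference_step (G := fun a b => a ^ 2 / 2 + 2 * a * b + b ^ 2 / 2)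
    (by fun_prop) (fun _ _ _ _ => by positivity)
    (fun _ _ ha hb => volume_cornerDifference_two ha hb) ha hb]
  congr 1
  have h1 : ∀ c d : ℝ, (∫ t in 0..c, ((c - t) ^ 2 / 2 + 2 * (c - t) * d + d ^ 2 / 2)) =
      c ^ 3 / 6 + c ^ 2 * d + c * d ^ 2 / 2 := by
    intro c d
    rw [intervalIntegral.integral_comp_sub_left (fun t => t ^ 2 / 2 + 2 * t * d + d ^ 2 / 2),
      intervalIntegral.integral_add
        (Continuous.intervalIntegrable (by fun_prop) _ _)
        (Continuous.intervalIntegrable (by fun_prop) _ _),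
      intervalIntegral.integral_add
        (Continuous.intervalIntegrable (by fun_prop) _ _)
        (Continuous.intervalIntegrable (by fun_prop) _ _)]
    simp only [mul_comm (2 : ℝ), intervalIntegral.integral_mul_const,
      intervalIntegral.integral_div, integral_pow, integral_id, intervalIntegral.integral_const]
    simp
    ring
  have h2 : (∫ t in 0..b, (a ^ 2 / 2 + 2 * a * (b - t) + (b - t) ^ 2 / 2)) =
      ∫ t in 0..b, ((b - t) ^ 2 / 2 + 2 * (b - t) * a + a ^ 2 / 2) := by
    congr 1; ext t; ring
  rw [h2, h1, h1]; ring

theorem mem_smul_cornerSimplex {n : ℕ} {a : ℝ} (ha : 0 ≤ a) {x : Fin n → ℝ} (hx : ∀ i, 0 ≤ x i)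
    (hs : ∑ i, x i ≤ a) : x ∈ a • {x : Fin n → ℝ | (∀ i, 0 ≤ x i) ∧ ∑ i, x i ≤ 1} := by
  rcases ha.eq_or_lt with rfl | ha
  · have h0 : x = 0 := by
      ext i
      exact le_antisymm ((Finset.single_le_sum (fun i _ => hx i) (Finset.mem_univ i)).trans hs)
        (hx i)
    exact ⟨0, by simp, by simp [h0]⟩
  · refine ⟨a⁻¹ • x, ⟨fun i => mul_nonneg (inv_nonneg.2 ha.le) (hx i), ?_⟩, ?_⟩
    · simp only [Pi.smul_apply, smul_eq_mul, ← Finset.mul_sum]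
      rwa [inv_mul_le_one₀ ha]
    · simp [smul_smul, ha.ne']

/-- Splitting `z` into its positive and negative parts is the most economical way to write it as a
difference of nonnegative vectors. -/
theorem smul_cornerSimplex_add_smul_neg {n : ℕ} {a b : ℝ} (ha : 0 ≤ a) (hb : 0 ≤ b) :
    a • {x : Fin n → ℝ | (∀ i, 0 ≤ x i) ∧ ∑ i, x i ≤ 1} +
      b • -{x : Fin n → ℝ | (∀ i, 0 ≤ x i) ∧ ∑ i, x i ≤ 1} = cornerDifference n a b := by
  apply Subset.antisymm
  · rintro _ ⟨_, ⟨x, ⟨hx, hxs⟩, rfl⟩, _, ⟨y, ⟨hy, hys⟩, rfl⟩, rfl⟩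
    simp only [Pi.neg_apply, Finset.sum_neg_distrib] at hy hys
    constructor
    · calc _ ≤ ∑ i, a * x i := Finset.sum_le_sum fun i _ => by
            simp only [Pi.add_apply, Pi.smul_apply, smul_eq_mul]
            exact max_le (by nlinarith [hy i]) (mul_nonneg ha (hx i))
        _ ≤ a := by rw [← Finset.mul_sum]; nlinarith
    · calc _ ≤ ∑ i, b * (-y i) := Finset.sum_le_sum fun i _ => by
            simp only [Pi.add_apply, Pi.smul_apply, smul_eq_mul]
            exact max_le (by nlinarith [mul_nonneg ha (hx i)]) (mul_nonneg hb (hy i))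
        _ ≤ b := by rw [← Finset.mul_sum, Finset.sum_neg_distrib]; nlinarith
  · rintro z ⟨h1, h2⟩
    refine ⟨_, mem_smul_cornerSimplex ha (fun i => le_max_right (z i) 0) h1,
      -fun i => max (-z i) 0, ?_, ?_⟩
    · rw [smul_set_neg, neg_mem_neg]
      exact mem_smul_cornerSimplex hb (fun i => le_max_right (-z i) 0) h2
    · ext i
      simp only [Pi.add_apply, Pi.neg_apply]
      rcases le_total (z i) 0 with h | h
      · simp [h]
      · simp [h]

/-! ### Hiding the family behind the tetrahedron. -/

/-- Among four points of a space of dimension at most two, a suitable point `x` is such that all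
`x - p i / 2` are convex combinations of the points. -/
theorem exists_sub_half_mem_convexHull {F : Type*} [AddCommGroup F] [Module ℝ F]
    [FiniteDimensional ℝ F] (hF : Module.finrank ℝ F ≤ 2) (p : Fin 4 → F) :
    ∃ x : F, ∀ i, x - (2⁻¹ : ℝ) • p i ∈ convexHull ℝ (range p) := by
  have hdep : ¬ AffineIndependent ℝ p := by
    intro h
    have h1 := h.card_le_finrank_succ
    have h2 := Submodule.finrank_le (vectorSpan ℝ (range p))
    simp only [Fintype.card_fin] at h1
    omega
  rw [affineIndependent_iff] at hdep
  push Not at hdep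
  obtain ⟨s, w, hw0, hwp, j, hj, hwj⟩ := hdep
  obtain ⟨m, hm0, hmp, hm⟩ : ∃ m : Fin 4 → ℝ, ∑ i, m i = 0 ∧ ∑ i, m i • p i = 0 ∧ m j ≠ 0 :=
    ⟨fun i => if i ∈ s then w i else 0, by simpa using hw0, by simpa [ite_smul] using hwp,
      by simpa [hj] using hwj⟩
  -- Dividing the affine dependence by its largest coefficient in absolute value makes every
  -- coefficient at least `-1`, and that of `p l` equal to `1`.
  obtain ⟨l, hl⟩ := Finite.exists_max fun i => |m i|
  have hml : m l ≠ 0 := fun h => hm (by simpa [h] using hl j)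
  have hle : ∀ i, -1 ≤ m i / m l := fun i => by
    have : |m i / m l| ≤ 1 := by
      rw [abs_div]; exact div_le_one_of_le₀ (hl i) (abs_nonneg _)
    exact (abs_le.1 this).1
  set x : F := (2⁻¹ : ℝ) • (∑ i, p i - p l) with hx
  have hsum : ∑ i, m i / m l = 0 := by rw [← Finset.sum_div, hm0, zero_div]
  have hsump : ∑ i, (m i / m l) • p i = 0 := by
    simp_rw [div_eq_inv_mul, mul_smul, ← Finset.smul_sum, hmp, smul_zero]
  refine ⟨x, fun i => ?_⟩
  have key : ∀ c : Fin 4 → ℝ, (∀ k, 0 ≤ c k) → ∑ k, c k = 1 → x - (2⁻¹ : ℝ) • p i = ∑ k, c k • p k →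
      x - (2⁻¹ : ℝ) • p i ∈ convexHull ℝ (range p) := by
    intro c h0 h1 h
    rw [h]
    exact (convex_convexHull ℝ _).sum_mem (fun k _ => h0 k) h1
      fun k _ => subset_convexHull ℝ _ (mem_range_self k)
  by_cases hil : i = l
  · subst hil
    -- Here `x - p l / 2 = (∑ p k - 2 p l) / 2`. Adding half the normalised dependence changes
    -- nothing, cancels the weight of `p l` to `0` and leaves the others nonnegative.
    refine key (fun k => 2⁻¹ * (1 + m k / m i - if k = i then 2 else 0)) (fun k => ?_) ?_ ?_
    · rcases eq_or_ne k i with rfl | h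
      · simp [hml]; norm_num
      · simp only [h, if_false]; linarith [hle k]
    · rw [← Finset.mul_sum, Finset.sum_sub_distrib, Finset.sum_add_distrib, hsum]
      simp; norm_num
    · simp_rw [mul_smul, ← Finset.smul_sum, sub_smul, add_smul, Finset.sum_sub_distrib,
        Finset.sum_add_distrib, hsump, ite_smul]
      simp only [one_smul, zero_smul, Finset.sum_ite_eq', Finset.mem_univ, if_true, hx]
      module
  -- For `i ≠ l` the point is the midpoint of the two vertices other than `p i` and `p l`.
  · refine key (fun k => 2⁻¹ * (1 - (if k = l then 1 else 0) - if k = i then 1 else 0))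
      (fun k => ?_) ?_ ?_
    · rcases eq_or_ne k i with rfl | h
      · simp [hil]
      · split_ifs <;> norm_num
    · rw [← Finset.mul_sum, Finset.sum_sub_distrib, Finset.sum_sub_distrib]
      simp; norm_num
    · simp_rw [mul_smul, ← Finset.smul_sum, sub_smul, Finset.sum_sub_distrib, ite_smul]
      simp only [one_smul, zero_smul, Finset.sum_ite_eq', Finset.mem_univ, if_true, hx]
      module

theorem exists_forall_sub_half_mem_convexHull {F : Type*} [AddCommGroup F] [Module ℝ F]
    [FiniteDimensional ℝ F] (hF : Module.finrank ℝ F ≤ 2) (p : Fin 4 → F) :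
    ∃ x : F, ∀ y ∈ convexHull ℝ (range p), x - (2⁻¹ : ℝ) • y ∈ convexHull ℝ (range p) := by
  obtain ⟨x, hx⟩ := exists_sub_half_mem_convexHull hF p
  refine ⟨x, fun y hy => convexHull_min (t := {y | x - (2⁻¹ : ℝ) • y ∈ convexHull ℝ (range p)})
    (range_subset_iff.2 hx) (fun y hy z hz a b ha hb hab => ?_) hy⟩
  have h := convex_convexHull ℝ (range p) hy hz ha hb hab
  simp only [mem_ofPred_eq]
  convert h using 1
  rw [smul_sub, smul_sub]
  nth_rw 1 [show x = (a + b) • x by rw [hab, one_smul]]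
  module

theorem canHideBehind_minkowskiInterpolation_convexHull (p : Fin 4 → EuclideanSpace ℝ (Fin 3))
    {α : ℝ} (hα : α ∈ Icc (0 : ℝ) 1) :
    CanHideBehind (minkowskiInterpolation α ((1 - α) / 2) (convexHull ℝ (range p))
      (-convexHull ℝ (range p))) (convexHull ℝ (range p)) := by
  intro u hu
  have hu0 : u ≠ 0 := by rintro rfl; simp at hu
  set P := (Submodule.span ℝ {u})ᗮ.orthogonalProjectionOnto
  have hF : Module.finrank ℝ (Submodule.span ℝ {u})ᗮ = 2 := by
    have : Fact (Module.finrank ℝ (EuclideanSpace ℝ (Fin 3)) = 2 + 1) := ⟨by simp⟩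
    exact Submodule.finrank_orthogonal_span_singleton hu0
  obtain ⟨x, hx⟩ := exists_forall_sub_half_mem_convexHull hF.le fun i => P (p i)
  have himg : P '' convexHull ℝ (range p) = convexHull ℝ (range fun i => P (p i)) := by
    rw [range_comp' P p]
    exact P.toLinearMap.image_convexHull _
  have hK := convex_convexHull ℝ (range fun i => P (p i))
  rw [himg]
  -- A translated point of the shadow is `α P y + (1 - α)(x - P(-z)/2)`, a convex combination of two
  -- points of the projected hull.
  refine ⟨(1 - α) • x, ?_⟩
  rintro _ ⟨_, ⟨_, ⟨_, ⟨y, hy, rfl⟩, _, ⟨z, hz, rfl⟩, rfl⟩, rfl⟩, rfl⟩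
  have h1 : P y ∈ convexHull ℝ (range fun i => P (p i)) := himg ▸ mem_image_of_mem P hy
  have h2 := hx (P (-z)) (himg ▸ mem_image_of_mem P hz)
  convert hK h1 h2 hα.1 (sub_nonneg.2 hα.2) (by ring) using 1
  simp only [vadd_eq_add, map_add, map_smul, map_neg]
  module

/-! ### Affine coordinates on the tetrahedron and the volume ratio. -/

theorem inner_sub_sub_of_dist_eq_one {ι E : Type*} [NormedAddCommGroup E] [InnerProductSpace ℝ E]
    {p : ι → E} (hp : ∀ i j, i ≠ j → dist (p i) (p j) = 1) {o i j : ι} (hi : i ≠ o) (hj : j ≠ o)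
    (hij : i ≠ j) : inner ℝ (p i - p o) (p j - p o) = 1 / 2 := by
  rw [real_inner_eq_norm_mul_self_add_norm_mul_self_sub_norm_sub_mul_self_div_two,
    sub_sub_sub_cancel_right, ← dist_eq_norm, ← dist_eq_norm, ← dist_eq_norm, hp _ _ hi,
    hp _ _ hj, hp _ _ hij]
  norm_num

theorem linearIndependent_sub_of_dist_eq_one {n : ℕ} {E : Type*} [NormedAddCommGroup E]
    [InnerProductSpace ℝ E] {p : Fin (n + 1) → E}
    (hp : ∀ i j, i ≠ j → dist (p i) (p j) = 1) :
    LinearIndependent ℝ fun i : Fin n => p i.succ - p 0 := by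
  rw [Fintype.linearIndependent_iff]
  intro c hc j
  have hgram : ∀ i j : Fin n, inner ℝ (p i.succ - p 0) (p j.succ - p 0) =
      1 / 2 + if i = j then (1 / 2 : ℝ) else 0 := by
    intro i j
    split_ifs with h
    · subst h
      rw [real_inner_self_eq_norm_sq, ← dist_eq_norm, hp _ _ (Fin.succ_ne_zero i)]; norm_num
    · rw [inner_sub_sub_of_dist_eq_one hp (Fin.succ_ne_zero i) (Fin.succ_ne_zero j)
        (fun h' => h (Fin.succ_injective n h')), add_zero]
  -- The Gram matrix is half of identity plus all-ones. Summing these equations over `j` gives `(n +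
  -- 1) ∑ c i = 0`, so every `c j` vanishes.
  have h : ∀ j, ∑ i, c i + c j = 0 := by
    intro j
    have h1 : inner ℝ (∑ i, c i • (p i.succ - p 0)) (p j.succ - p 0) = 0 := by
      rw [hc, inner_zero_left]
    simp only [sum_inner, real_inner_smul_left, hgram, mul_add, Finset.sum_add_distrib,
      ← Finset.sum_mul, mul_ite, mul_zero, Finset.sum_ite_eq', Finset.mem_univ, if_true] at h1
    linarith
  have h2 : ∑ j, (∑ i, c i + c j) = 0 := Finset.sum_eq_zero fun j _ => h j
  rw [Finset.sum_add_distrib, Finset.sum_const, Finset.card_univ, Fintype.card_fin,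
    nsmul_eq_mul] at h2
  have h3 : ∑ i, c i = 0 := by
    have : ((n : ℝ) + 1) * ∑ i, c i = 0 := by linarith
    exact (mul_eq_zero.1 this).resolve_left (by positivity)
  linarith [h j]

/-- By uniqueness of Haar measure. The value of `c` is irrelevant, as it cancels in volume ratios.
-/
theorem exists_volume_image_linearEquiv {n : ℕ} (e : (Fin n → ℝ) ≃ₗ[ℝ] EuclideanSpace ℝ (Fin n)) :
    ∃ c : ℝ, 0 < c ∧ ∀ s, volume.real (e '' s) = c * volume.real s := by
  set e' := e.toContinuousLinearEquiv
  have : (Measure.map e'.symm volume).IsAddHaarMeasure := inferInstance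
  refine ⟨_, NNReal.coe_pos.2 (Measure.addHaarScalarFactor_pos_of_isAddHaarMeasure
    (Measure.map e'.symm volume) volume), fun s => ?_⟩
  have h : Measure.map e'.symm volume s = volume (e '' s) := by
    have := e'.symm.toHomeomorph.toMeasurableEquiv.map_apply (μ := volume) s
    refine this.trans (congrArg _ ?_)
    exact (e'.image_eq_preimage_symm s).symm
  have h2 := congrArg (fun μ => (μ s).toReal) (Measure.isAddLeftInvariant_eq_smul
    (Measure.map e'.symm volume) (volume : Measure (Fin n → ℝ)))
  rw [measureReal_def, ← h]
  exact h2.trans ENNReal.toReal_mul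

theorem convexHull_eq_vadd_image_cornerSimplex {n : ℕ} {E : Type*} [AddCommGroup E] [Module ℝ E]
    {p : Fin (n + 1) → E} (e : (Fin n → ℝ) →ₗ[ℝ] E)
    (he : ∀ x, e x = ∑ i, x i • (p i.succ - p 0)) :
    convexHull ℝ (range p) = p 0 +ᵥ e '' {x | (∀ i, 0 ≤ x i) ∧ ∑ i, x i ≤ 1} := by
  apply Subset.antisymm
  · refine convexHull_min ?_ (Convex.vadd (Convex.linear_image ?_ e) _)
    · rintro _ ⟨i, rfl⟩
      refine Fin.cases ?_ (fun i => ?_) i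
      · exact ⟨e 0, ⟨0, by simp, rfl⟩, by simp⟩
      · refine ⟨e (Pi.single i 1), ⟨Pi.single i 1, ⟨fun j => ?_, by simp⟩, rfl⟩, ?_⟩
        · rw [Pi.single_apply]; split_ifs <;> simp
        · simp [he, Pi.single_apply]
    · rintro x ⟨hx, hxs⟩ y ⟨hy, hys⟩ a b ha hb hab
      refine ⟨fun i => add_nonneg (mul_nonneg ha (hx i)) (mul_nonneg hb (hy i)), ?_⟩
      simp only [Pi.add_apply, Pi.smul_apply, smul_eq_mul, Finset.sum_add_distrib,
        ← Finset.mul_sum]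
      nlinarith
  · rintro _ ⟨_, ⟨x, ⟨hx, hxs⟩, rfl⟩, rfl⟩
    have h : p 0 +ᵥ e x = ∑ i, (Fin.cons (1 - ∑ i, x i) x : Fin (n + 1) → ℝ) i • p i := by
      simp only [he, smul_sub, Finset.sum_sub_distrib, ← Finset.sum_smul, Fin.sum_univ_succ,
        Fin.cons_zero, Fin.cons_succ, vadd_eq_add]
      module
    change p 0 +ᵥ e x ∈ _
    rw [h]
    refine (convex_convexHull ℝ _).sum_mem (fun i _ => ?_) ?_
      fun i _ => subset_convexHull ℝ _ (mem_range_self i)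
    · refine Fin.cases ?_ (fun i => ?_) i
      · simpa using hxs
      · simpa using hx i
    · simp [Fin.sum_univ_succ]

theorem volumeRatio_minkowskiInterpolation {T : Set (EuclideanSpace ℝ (Fin 3))}
    (hT : IsUnitRegularTetrahedron T) {α β : ℝ} (hα : 0 ≤ α) (hβ : 0 ≤ β) :
    volumeRatio (minkowskiInterpolation α β T (-T)) T =
      α ^ 3 + 9 * α ^ 2 * β + 9 * α * β ^ 2 + β ^ 3 := by
  obtain ⟨p, hp, rfl⟩ := hT
  set B := basisOfLinearIndependentOfCardEqFinrank (linearIndependent_sub_of_dist_eq_one hp)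
    (by simp) with hB
  set e := B.equivFun.symm
  have he : ∀ x, e x = ∑ i, x i • (p i.succ - p 0) := fun x => by
    simp [e, hB]
  obtain ⟨c, hc, hvol⟩ := exists_volume_image_linearEquiv e
  have hhull := convexHull_eq_vadd_image_cornerSimplex (p := p) e.toLinearMap he
  set S : Set (Fin 3 → ℝ) := {x | (∀ i, 0 ≤ x i) ∧ ∑ i, x i ≤ 1}
  have himg : ∀ {a b : ℝ}, 0 ≤ a → 0 ≤ b →
      minkowskiInterpolation a b (convexHull ℝ (range p)) (-convexHull ℝ (range p)) =
        ((a - b) • p 0) +ᵥ e '' cornerDifference 3 a b := by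
    intro a b ha hb
    rw [← smul_cornerSimplex_add_smul_neg ha hb, hhull]
    ext z
    constructor
    · rintro ⟨_, ⟨_, ⟨_, ⟨x, hx, rfl⟩, rfl⟩, rfl⟩, _, ⟨y, ⟨_, ⟨w, hw, hwy⟩, hy⟩, rfl⟩, rfl⟩
      refine ⟨_, ⟨_, ⟨a • x, ⟨x, hx, rfl⟩, b • (-w), ⟨-w, neg_mem_neg.2 hw, rfl⟩, rfl⟩, rfl⟩, ?_⟩
      have hy' : y = -(p 0 + e w) := by
        rw [← neg_neg y, ← hy, ← hwy]; rfl
      simp only [hy', vadd_eq_add, map_add, map_smul, map_neg, LinearEquiv.coe_coe]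
      module
    · rintro ⟨_, ⟨_, ⟨_, ⟨x, hx, rfl⟩, _, ⟨y, hy, rfl⟩, rfl⟩, rfl⟩, rfl⟩
      refine ⟨_, ⟨_, ⟨e x, ⟨x, hx, rfl⟩, rfl⟩, rfl⟩, _,
        ⟨-(p 0 + e (-y)), ?_, rfl⟩, ?_⟩
      · rw [neg_mem_neg]
        exact ⟨_, ⟨-y, hy, rfl⟩, rfl⟩
      · simp only [vadd_eq_add, map_add, map_smul, map_neg]
        module
  have hV : ∀ {a b : ℝ}, 0 ≤ a → 0 ≤ b →
      volume.real (minkowskiInterpolation a b (convexHull ℝ (range p))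
        (-convexHull ℝ (range p))) =
        c * ((a ^ 3 + 9 * a ^ 2 * b + 9 * a * b ^ 2 + b ^ 3) / 6) := by
    intro a b ha hb
    rw [himg ha hb, measureReal_def, measure_vadd, ← measureReal_def, hvol, measureReal_def,
      volume_cornerDifference_three ha hb, ENNReal.toReal_ofReal (by positivity)]
  have hself : minkowskiInterpolation 1 0 (convexHull ℝ (range p)) (-convexHull ℝ (range p)) =
      convexHull ℝ (range p) := by
    rw [minkowskiInterpolation, one_smul, zero_smul_set, add_zero]
    exact (convexHull_nonempty_iff.2 (range_nonempty p)).neg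
  -- The denominator is the case `a = 1`, `b = 0` of the same formula.
  have hVT := hV zero_le_one le_rfl
  rw [hself] at hVT
  rw [volumeRatio, hV hα hβ, hVT]
  field_simp
  ring

/-! ### The necessary condition for hiding. -/

theorem add_two_mul_le_one_of_canHideBehind {T : Set (EuclideanSpace ℝ (Fin 3))}
    (hT : IsUnitRegularTetrahedron T) {α β : ℝ}
    (h : CanHideBehind (minkowskiInterpolation α β T (-T)) T) : α + 2 * β ≤ 1 := by
  obtain ⟨p, hp, rfl⟩ := hT
  -- inner products of the edge vectors at the apex
  set v : Fin 3 → EuclideanSpace ℝ (Fin 3) := fun i => p i.succ - p 0 with hv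
  have hgram : ∀ i j : Fin 3, inner ℝ (v i) (v j) = if i = j then (1 : ℝ) else 1 / 2 := by
    intro i j
    split_ifs with hij
    · subst hij
      rw [real_inner_self_eq_norm_sq, hv, ← dist_eq_norm, hp _ _ (Fin.succ_ne_zero i)]; norm_num
    · exact inner_sub_sub_of_dist_eq_one hp (Fin.succ_ne_zero i) (Fin.succ_ne_zero j)
        fun h' => hij (Fin.succ_injective 3 h')
  -- The direction of the altitude from `p 0`, along which the shadow is an equilateral triangle
  -- with `p 0` over its centre.
  set d : EuclideanSpace ℝ (Fin 3) := ∑ i, v i with hd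
  have hvd : ∀ i, inner ℝ (v i) d = 2 := by
    intro i
    simp only [hd, inner_sum, hgram]
    fin_cases i <;> simp [Fin.sum_univ_three] <;> norm_num
  have hdd : inner ℝ d d = (6 : ℝ) := by
    nth_rw 1 [hd]
    simp only [sum_inner, hvd]
    norm_num
  have hd0 : d ≠ 0 := by rintro h0; simp [h0] at hdd
  -- Twice the component of `v i` orthogonal to `d`. Relative to `p 0`, `w i` takes the value `2/3`
  -- at vertex `i.succ`, `-1/3` at the other two base vertices and `0` at the apex.
  set w : Fin 3 → EuclideanSpace ℝ (Fin 3) := fun i => (2 : ℝ) • v i - (2 / 3 : ℝ) • d with hw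
  have hwd : ∀ i, inner ℝ (w i) d = 0 := fun i => by
    simp only [hw, inner_sub_left, real_inner_smul_left, hvd, hdd]; norm_num
  have hwv : ∀ i j, inner ℝ (w i) (v j) = if i = j then (2 / 3 : ℝ) else -(1 / 3) := by
    intro i j
    simp only [hw, inner_sub_left, real_inner_smul_left, real_inner_comm (v j) d, hvd, hgram]
    split_ifs <;> norm_num
  have hw0 : ∑ i, w i = 0 := by
    simp only [hw, Finset.sum_sub_distrib, ← Finset.smul_sum, ← hd, Finset.sum_const,
      Finset.card_univ, Fintype.card_fin]
    module
  have hp0 : ∀ i j, inner ℝ (w i) (p j.succ) = inner ℝ (w i) (p 0) + inner ℝ (w i) (v j) :=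
    fun i j => by rw [← inner_add_right]; simp [hv]
  have hmin : ∀ i, ∀ b ∈ convexHull ℝ (range p),
      inner ℝ (w i) (p 0) - 1 / 3 ≤ inner ℝ (w i) b := by
    intro i
    refine convexHull_min (t := {b | inner ℝ (w i) (p 0) - 1 / 3 ≤ inner ℝ (w i) b}) ?_
      (convex_halfSpace_ge (innerₛₗ ℝ (w i)).isLinear _)
    rintro _ ⟨k, rfl⟩
    refine Fin.cases ?_ (fun j => ?_) k
    · simp
    · rw [mem_ofPred_eq, hp0, hwv]
      split_ifs <;> linarith
  obtain ⟨x, hx⟩ := h ((‖d‖⁻¹ : ℝ) • d) (norm_smul_inv_norm hd0)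
  have hwu : ∀ i, w i ∈ (Submodule.span ℝ {(‖d‖⁻¹ : ℝ) • d})ᗮ := fun i => by
    rw [Submodule.mem_orthogonal_singleton_iff_inner_left, real_inner_smul_right, hwd, mul_zero]
  have key : ∀ i, inner ℝ (w i) (p 0) - 1 / 3 ≤ inner ℝ (w i) (x : EuclideanSpace ℝ (Fin 3)) +
      (α * (inner ℝ (w i) (p 0) - 1 / 3) - β * (inner ℝ (w i) (p 0) + 2 / 3)) := by
    intro i
    -- A point with `w i` value `-α/3 - 2β/3`, up to the contribution of `p 0`. The sum `i + 1` is
    -- cyclic in `Fin 3`; only `i + 1 ≠ i` matters.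
    have hmem : α • p (i + 1).succ + β • -p i.succ ∈
        minkowskiInterpolation α β (convexHull ℝ (range p)) (-convexHull ℝ (range p)) :=
      add_mem_add (smul_mem_smul_set (subset_convexHull ℝ _ (mem_range_self _)))
        (smul_mem_smul_set (neg_mem_neg.2 (subset_convexHull ℝ _ (mem_range_self _))))
    obtain ⟨b, hb, hbx⟩ := hx (vadd_mem_vadd_set (mem_image_of_mem _ hmem))
    have hi : i ≠ i + 1 := by fin_cases i <;> decide
    -- Since `w i` lies in the plane, pairing with it does not see the projection.
    have h1 := congrArg (fun y => inner ℝ (⟨w i, hwu i⟩ : (Submodule.span ℝ {(‖d‖⁻¹ : ℝ) • d})ᗮ) y)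
      hbx
    simp only [vadd_eq_add, inner_add_right, Submodule.inner_orthogonalProjectionOnto_eq_of_mem_left,
      real_inner_smul_right, inner_neg_right, hp0, hwv, if_neg hi, if_true] at h1
    rw [Submodule.coe_inner] at h1
    have h2 := hmin i b hb
    rw [h1] at h2
    dsimp only at h2
    linarith
  -- Summing `key` over `i` removes the translation `x` and the base point `p 0`, leaving `-1 ≤ -α -
  -- 2β`.
  have hsum : ∀ y, ∑ i, inner ℝ (w i) y = 0 := fun y => by rw [← sum_inner, hw0, inner_zero_left]
  have h1 := hsum (p 0)
  have h2 := hsum x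
  rw [Fin.sum_univ_three] at h1 h2
  have h3 : inner ℝ (w 2) (p 0) = -(inner ℝ (w 0) (p 0) + inner ℝ (w 1) (p 0)) := by linarith
  have k2 := key 2
  rw [h3] at k2
  linarith [key 0, key 1]

/-! ### Optimisation of the cubic and numerical values. -/

theorem sqrt_fourteen_bounds : (3.7416573867 : ℝ) < √14 ∧ √14 < 3.7416573868 :=
  ⟨Real.lt_sqrt_of_sq_lt (by norm_num), (Real.sqrt_lt' (by norm_num)).2 (by norm_num)⟩

theorem mainTheorem1 (T : Set (EuclideanSpace ℝ (Fin 3))) (hT : IsUnitRegularTetrahedron T) :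
    -- every body of the family can hide behind `T`
    (∀ α ∈ Icc (0 : ℝ) 1,
      CanHideBehind (minkowskiInterpolation α ((1 - α) / 2) T (-T)) T) ∧
    -- within the family the volume ratio is maximal exactly at `α = (1 + 2√14) / 11`
    (1 + 2 * √14) / 11 ∈ Icc (0 : ℝ) 1 ∧
    (∀ α ∈ Icc (0 : ℝ) 1, α ≠ (1 + 2 * √14) / 11 →
      volumeRatio (minkowskiInterpolation α ((1 - α) / 2) T (-T)) T <
        volumeRatio (minkowskiInterpolation ((1 + 2 * √14) / 11)
          ((1 - (1 + 2 * √14) / 11) / 2) T (-T)) T) ∧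
    -- this is also the maximum over all interpolations `α T + β (-T)` that can hide behind `T`
    (∀ α β : ℝ, 0 ≤ α → 0 ≤ β → CanHideBehind (minkowskiInterpolation α β T (-T)) T →
      volumeRatio (minkowskiInterpolation α β T (-T)) T ≤
        volumeRatio (minkowskiInterpolation ((1 + 2 * √14) / 11)
          ((1 - (1 + 2 * √14) / 11) / 2) T (-T)) T) ∧
    -- the maximal ratio, exactly
    volumeRatio (minkowskiInterpolation ((1 + 2 * √14) / 11)
      ((1 - (1 + 2 * √14) / 11) / 2) T (-T)) T = (36 + 28 * √14) / 121 ∧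
    -- the numerical values, correctly rounded to the displayed digits
    |(1 + 2 * √14) / 11 - (0.77121043 : ℝ)| < 5 / 10 ^ 9 ∧
    |volumeRatio (minkowskiInterpolation ((1 + 2 * √14) / 11)
      ((1 - (1 + 2 * √14) / 11) / 2) T (-T)) T - (1.1633587 : ℝ)| < 5 / 10 ^ 8 := by
  set a : ℝ := (1 + 2 * √14) / 11 with ha
  obtain ⟨hlo, hhi⟩ := sqrt_fourteen_bounds
  have hs : √14 ^ 2 = 14 := Real.sq_sqrt (by norm_num)
  have ha0 : 0 ≤ a := by positivity
  have ha1 : a ≤ 1 := by rw [ha]; linarith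
  -- Vanishing of the derivative of the cubic in `hfam` at `a`.
  have hcrit : 11 * a ^ 2 = 2 * a + 5 := by
    have : √14 = (11 * a - 1) / 2 := by rw [ha]; ring
    rw [this] at hs
    linarith
  have hfam : ∀ α ∈ Icc (0 : ℝ) 1, volumeRatio (minkowskiInterpolation α ((1 - α) / 2) T (-T)) T =
      (-11 * α ^ 3 + 3 * α ^ 2 + 15 * α + 1) / 8 := by
    intro α hα
    rw [volumeRatio_minkowskiInterpolation hT hα.1 (by linarith [hα.2])]
    ring
  -- Since `a` is critical, the gap has a double root there; the remaining linear factor is positive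
  -- for all `α ≥ 0` because `22a > 3`. This gives both maximality and uniqueness.
  have hgap : ∀ α : ℝ, (-11 * a ^ 3 + 3 * a ^ 2 + 15 * a + 1) / 8 -
      (-11 * α ^ 3 + 3 * α ^ 2 + 15 * α + 1) / 8 = (α - a) ^ 2 * (11 * α + 22 * a - 3) / 8 := by
    intro α
    linear_combination (3 / 8 * (α - a)) * hcrit
  have hcoef : 0 < 22 * a - 3 := by rw [ha]; linarith
  have hval : (-11 * a ^ 3 + 3 * a ^ 2 + 15 * a + 1) / 8 = (36 + 28 * √14) / 121 := by
    have : √14 = (11 * a - 1) / 2 := by rw [ha]; ring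
    rw [this]
    linear_combination (-a / 8 + 1 / 88) * hcrit
  have hstar := (hfam a ⟨ha0, ha1⟩).trans hval
  refine ⟨fun α hα => ?_, ⟨ha0, ha1⟩, fun α hα hne => ?_, fun α β hα hβ h => ?_, hstar, ?_, ?_⟩
  · obtain ⟨p, -, rfl⟩ := hT
    exact canHideBehind_minkowskiInterpolation_convexHull p hα
  · rw [hfam α hα, hfam a ⟨ha0, ha1⟩, ← sub_pos, hgap]
    have := hα.1
    have := pow_pos (abs_pos.2 (sub_ne_zero.2 hne)) 2
    rw [sq_abs] at this
    exact div_pos (mul_pos this (by linarith)) (by norm_num)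
  · have hab := add_two_mul_le_one_of_canHideBehind hT h
    have hβ' : β ≤ (1 - α) / 2 := by linarith
    calc volumeRatio (minkowskiInterpolation α β T (-T)) T
        = α ^ 3 + 9 * α ^ 2 * β + 9 * α * β ^ 2 + β ^ 3 :=
          volumeRatio_minkowskiInterpolation hT hα hβ
      -- The ratio is monotone in `β`, so `β` may be raised to the family's value.
      _ ≤ α ^ 3 + 9 * α ^ 2 * ((1 - α) / 2) + 9 * α * ((1 - α) / 2) ^ 2 + ((1 - α) / 2) ^ 3 := by
          gcongr
      _ = (-11 * α ^ 3 + 3 * α ^ 2 + 15 * α + 1) / 8 := by ring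
      _ ≤ _ := by
          rw [hfam a ⟨ha0, ha1⟩, ← sub_nonneg, hgap]
          have : 0 ≤ 11 * α + 22 * a - 3 := by linarith
          positivity
  · rw [abs_lt]
    constructor <;> rw [ha] <;> norm_num at hlo hhi ⊢ <;> linarith
  · rw [hstar, abs_lt]
    constructor <;> norm_num at hlo hhi ⊢ <;> linarith
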